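/- Let $d\ge 1$ and let $\Phi$ be a finite $\mathbb Z^d$-gain graph with vertex set $V=\{v_1,\dots,v_n\}$: multiple edges are allowed, and each link or loop $e$ has a gain $\phi(e)\in\mathbb Z^d$, which is negated when the orientation of $e$ is reversed. Half edges (with one endpoint and no gain) are also allowed. Assume that $\Phi$ has no balanced loops (loops of gain $0$) and no loose edges (edges without endpoints). Order $\mathbb Z^d$ componentwise; let $\vee,\wedge$ be componentwise max and min, and $\langle a\rangle^*=\{x\in\mathbb Z^d: x\ge a\}$. Let each vertex $v_i$ have a color list $\mathfrak h_i\subset\mathbb Z^d$ in the class $\mathfrak W_2$, i.e. of the form $\langle a\rangle^*\setminus A$ with $a\in\mathbb Z^d$ and $A\subset\langle a\rangle^*$ finite. Let $h_i=(h_{i1},\dots,h_{id})$ be the meet of the members of $\mathfrak h_i$, let $\bar H_i=\langle h_i\rangle^*\setminus\mathfrak h_i$, and let $\hat h_i=\bigvee\bar H_i$ if $\bar H_i\ne\emptyset$ and $\hat h_i=h_i-(1,\dots,1)$ otherwise. Let $\alpha_j(\Phi)$ be the join of the gains of all paths in $\Phi$ that begin at $v_j$ (the path of length $0$ included). For $m\in(\mathbb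 Z^d)^n$ let $\chi(m)=\chi(m_1,\dots,m_n)$ be the number of $x:V\to\mathbb Z^d$ with $x_i\in\mathfrak h_i$ and $x_i\le m_i$ for all $i$, and $x_j\ne x_i+\phi(e_{ij})$ for each link or loop $e_{ij}$. An edge set is balanced if it contains no half edge and every circle in it has gain $0$. A balanced set is closed if it contains every edge whose endpoints are joined by a path in the set with the same gain as the edge. Let $\mathcal L$ be the poset of closed balanced edge sets ordered by inclusion, with Möbius function $\mu$. For $B\in\mathcal L$ let $\pi(B)$ be the partition of $V$ into the vertex sets of the connected components of $(V,B)$, and let $\eta_B:V\to\mathbb Z^d$ be the unique function such that $\eta_B(v_i)=\phi(e_{ij})+\eta_B(v_j)$ for every edge $e_{ij}\in B$ and $\bigwedge_{v\in W}\eta_B(v)=0$ for every $W\in\pi(B)$. For $m'\in\mathbb Z^d$ define $$\bar q_k(B,W)=m'_k-\max_{v_i,v_j\in W}\bigl(h_{ik}+\eta_B(v_i)_k-\eta_B(v_j)_k\bigr)+1,$$ $$\bar p(m')=\sum_{B\in\mathcal L}\mu(\emptyset,B)\prod_{W\in\pi(B)}\Bigl(\prod_{k=1}^d\bar q_k(B,W)-\Bigl|\bigcup_{v_i\in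 W}\bigl(\bar H_i+\eta_B(v_i)\bigr)\cap\Bigl\langle\bigvee_{v_i\in W}\bigl(h_i+\eta_B(v_i)\bigr)\Bigr\rangle^*\Bigr|\Bigr).$$ Then $\bar p$ is a polynomial function of the $d$ variables $m'_1,\dots,m'_d$ (with integer coefficients), of degree at most $n$ in each variable and with leading term (top-degree homogeneous part) $\prod_{k=1}^d(m'_k)^n$. Moreover, for all $m'\in\mathbb Z^d$ with $m'\ge\hat h_j+\alpha_j(\Phi)$ for every $j$, i.e. $m'\ge\bigvee_{j=1}^n\bigl(\hat h_j+\alpha_j(\Phi)\bigr)$, the number $\chi(m',\dots,m')$ is finite and equals $\bar p(m')$. -/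

import Mathlib

/-- The kinds of edges of a gain graph: a link or loop `ordinary u v g`, which has gain `g` when
oriented from `u` to `v` (hence gain `-g` when oriented from `v` to `u`), a half edge with its
single endpoint, and a loose edge, which has no endpoints. -/
inductive EdgeKind (V G : Type*)
  | ordinary (u v : V) (g : G)
  | half (v : V)
  | loose

/-- A gain graph with vertex set `V`, edge set `E` (multiple edges allowed) and additively written
abelian gain group `G`. -/
structure GainGraph (V E G : Type*) where
  kind : E → EdgeKind V G

namespace GainGraph

/-- `Φ.Traverses e u v g`: the edge `e` can be oriented from `u` to `v`, and then has gain `g`. -/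
inductive Traverses {V E G : Type*} [AddCommGroup G] (Φ : GainGraph V E G) (e : E) :
    V → V → G → Prop
  | fwd {u v : V} {g : G} (h : Φ.kind e = EdgeKind.ordinary u v g) : Traverses Φ e u v g
  | bwd {u v : V} {g : G} (h : Φ.kind e = EdgeKind.ordinary u v g) : Traverses Φ e v u (-g)

/-- Walks in a gain graph. -/
inductive Walk {V E G : Type*} [AddCommGroup G] (Φ : GainGraph V E G) : V → V → Type _
  | nil (v : V) : Walk Φ v v
  | cons {u v w : V} (e : E) (g : G) (h : Φ.Traverses e u v g) (p : Walk Φ v w) : Walk Φ u w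

namespace Walk

/-- The gain of a walk: the sum of the gains of its edges, oriented along the walk. -/
def gain {V E G : Type*} [AddCommGroup G] {Φ : GainGraph V E G} :
    {u v : V} → Walk Φ u v → G
  | _, _, nil _ => 0
  | _, _, cons _ g _ p => g + p.gain

/-- The list of vertices of a walk, in order. -/
def support {V E G : Type*} [AddCommGroup G] {Φ : GainGraph V E G} :
    {u v : V} → Walk Φ u v → List V
  | _, _, nil v => [v]
  | u, _, cons _ _ _ p => u :: p.support

/-- The list of edges of a walk, in order. -/
def edges {V E G : Type*} [AddCommGroup G] {Φ : GainGraph V E G} :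
    {u v : V} → Walk Φ u v → List E
  | _, _, nil _ => []
  | _, _, cons e _ _ p => e :: p.edges

/-- A path does not repeat vertices; the path of length `0` is allowed. -/
def IsPath {V E G : Type*} [AddCommGroup G] {Φ : GainGraph V E G} {u v : V}
    (p : Walk Φ u v) : Prop :=
  p.support.Nodup

/-- A closed walk that goes once around a circle (a connected 2-regular subgraph): it has positive
length, its edges are distinct, and so are its vertices except that the first is also the last.
Loops and digons are circles. -/
def IsCircle {V E G : Type*} [AddCommGroup G] {Φ : GainGraph V E G} {v : V}
    (p : Walk Φ v v) : Prop :=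
  p.edges ≠ [] ∧ p.edges.Nodup ∧ p.support.tail.Nodup

/-- The walk uses only edges of `S`. -/
def InSet {V E G : Type*} [AddCommGroup G] {Φ : GainGraph V E G} {u v : V}
    (p : Walk Φ u v) (S : Finset E) : Prop :=
  ∀ e ∈ p.edges, e ∈ S

end Walk

/-- An edge set is balanced if it has no half edges and each of its circles has identity gain. -/
def Balanced {V E G : Type*} [AddCommGroup G] (Φ : GainGraph V E G) (S : Finset E) : Prop :=
  (∀ e ∈ S, ∀ v, Φ.kind e ≠ EdgeKind.half v) ∧
    ∀ (v : V) (p : Walk Φ v v), p.IsCircle → p.InSet S → p.gain = 0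

/-- An edge set is closed if it contains every edge whose endpoints are joined by a path in the set
with the same gain as the edge. (So balanced loops belong to every closed set; loose edges, which
are treated like balanced loops, also do.) It is used for balanced sets only. -/
def Closed {V E G : Type*} [AddCommGroup G] (Φ : GainGraph V E G) (S : Finset E) : Prop :=
  (∀ (e : E) (u v : V) (g : G), Φ.Traverses e u v g →
      (∃ p : Walk Φ u v, p.IsPath ∧ p.InSet S ∧ p.gain = g) → e ∈ S) ∧
    ∀ e : E, Φ.kind e = EdgeKind.loose → e ∈ S

/-- The semilattice of closed, balanced edge sets, ordered by inclusion. -/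
abbrev LatB {V E G : Type*} [AddCommGroup G] (Φ : GainGraph V E G) : Type _ :=
  {B : Finset E // Φ.Balanced B ∧ Φ.Closed B}

noncomputable instance {V E G : Type*} [AddCommGroup G] [Finite E] (Φ : GainGraph V E G) :
    Fintype Φ.LatB :=
  Fintype.ofFinite _

open Classical in
/-- The Möbius function value `μ(∅, B)` of the poset `LatB`, with the convention that it is `0` if
the empty set is not closed. -/
noncomputable def muEmpty {V E G : Type*} [AddCommGroup G] [Finite E] (Φ : GainGraph V E G)
    (B : Φ.LatB) : ℤ :=
  letI : LocallyFiniteOrder Φ.LatB := Fintype.toLocallyFiniteOrder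
  if h : Φ.Balanced ∅ ∧ Φ.Closed ∅ then IncidenceAlgebra.mu ℤ (⟨∅, h⟩ : Φ.LatB) B else 0

open Classical in
/-- The vertex set of the connected component of `v` in the spanning subgraph with edge set `S`. -/
noncomputable def component {V E G : Type*} [AddCommGroup G] [Fintype V] (Φ : GainGraph V E G)
    (S : Finset E) (v : V) : Finset V :=
  Finset.univ.filter fun w => ∃ p : Walk Φ v w, p.InSet S

open Classical in
/-- The partition `π(S)` of the vertex set into the vertex sets of the components of `S`. -/
noncomputable def parts {V E G : Type*} [AddCommGroup G] [Fintype V] (Φ : GainGraph V E G)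
    (S : Finset E) : Finset (Finset V) :=
  Finset.univ.image (Φ.component S)

/-- `η` is the top switching function for `S`: switching by `η` makes all gains in `S` zero, and the
meet of the values of `η` on each component of `S` is the identity of the gain group. -/
def IsTopSwitching {V E G : Type*} [AddCommGroup G] [Lattice G] [Fintype V]
    (Φ : GainGraph V E G) (S : Finset E) (η : V → G) : Prop :=
  (∀ e ∈ S, ∀ (u v : V) (g : G), Φ.Traverses e u v g → -η u + g + η v = 0) ∧
    ∀ W ∈ Φ.parts S, IsGLB (η '' (W : Set V)) 0

/-- The top switching function of `S` (which exists and is unique when `S` is balanced). -/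
noncomputable def topSwitching {V E G : Type*} [AddCommGroup G] [Lattice G] [Fintype V]
    (Φ : GainGraph V E G) (S : Finset E) : V → G :=
  Classical.epsilon fun η => Φ.IsTopSwitching S η

/-- `α_j(Φ)`: the least upper bound of the gains of all paths that begin at `v`. -/
noncomputable def pathGainSup {V E : Type*} {d : ℕ} (Φ : GainGraph V E (Fin d → ℤ)) (v : V) :
    Fin d → ℤ :=
  sSup {g | ∃ (w : V) (p : Walk Φ v w), p.IsPath ∧ p.gain = g}

end GainGraph

/-- Membership of a color list in the weight class `𝔚₂`: the list is a cone
`{x | a ≤ x}` with a finite set of points removed. -/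
def IsW2 {d : ℕ} (H : Set (Fin d → ℤ)) : Prop :=
  BddBelow H ∧ ∃ (a : Fin d → ℤ) (A : Set (Fin d → ℤ)), A.Finite ∧ A ⊆ Set.Ici a ∧ H = Set.Ici a \ A

/-- The meet of the members of the list `H`. -/
noncomputable def listBase {d : ℕ} (H : Set (Fin d → ℤ)) : Fin d → ℤ :=
  sInf H

/-- The points of the cone above `listBase H` that are missing from `H`. -/
def listGaps {d : ℕ} (H : Set (Fin d → ℤ)) : Set (Fin d → ℤ) :=
  Set.Ici (listBase H) \ H

open Classical in
/-- The join of `listGaps H`, or `listBase H - (1, …, 1)` if there are no gaps. -/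
noncomputable def listHat {d : ℕ} (H : Set (Fin d → ℤ)) : Fin d → ℤ :=
  if listGaps H = ∅ then listBase H - 1 else sSup (listGaps H)

namespace GainGraph

/-- The proper list colorations of `(Φ, H)` with upper bounds `m`. -/
def properColorations {V E : Type*} {d : ℕ} (Φ : GainGraph V E (Fin d → ℤ))
    (H : V → Set (Fin d → ℤ)) (m : V → Fin d → ℤ) : Set (V → Fin d → ℤ) :=
  {x | (∀ i, x i ∈ H i) ∧ x ≤ m ∧
    ∀ (e : E) (i j : V) (g : Fin d → ℤ), Φ.Traverses e i j g → x j ≠ x i + g}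

/-- The list chromatic function: the number of proper list colorations with upper bounds `m`. -/
noncomputable def chi {V E : Type*} {d : ℕ} (Φ : GainGraph V E (Fin d → ℤ))
    (H : V → Set (Fin d → ℤ)) (m : V → Fin d → ℤ) : ℕ :=
  (Φ.properColorations H m).ncard

/-- `q̄_k(B, W) = m'_k - max_{i, j ∈ W} (h_{ik} + η_B(i)_k - η_B(j)_k) + 1`. -/
noncomputable def qBar {V E : Type*} {d : ℕ} [Fintype V] (Φ : GainGraph V E (Fin d → ℤ))
    (H : V → Set (Fin d → ℤ)) (B : Finset E) (W : Finset V) (m' : Fin d → ℤ) (k : Fin d) : ℤ :=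
  m' k - sSup ((fun p : V × V =>
      listBase (H p.1) k + Φ.topSwitching B p.1 k - Φ.topSwitching B p.2 k) ''
    ((W : Set V) ×ˢ (W : Set V))) + 1

/-- The points of the contracted cone `{x | ∀ i ∈ W, h_i + η_B(i) ≤ x}` that lie in one of the
translated gap sets `H̄_i + η_B(i)`, `i ∈ W`. -/
noncomputable def gapsOn {V E : Type*} {d : ℕ} [Fintype V] (Φ : GainGraph V E (Fin d → ℤ))
    (H : V → Set (Fin d → ℤ)) (B : Finset E) (W : Finset V) : Set (Fin d → ℤ) :=
  (⋃ i ∈ W, (fun x => x + Φ.topSwitching B i) '' listGaps (H i)) ∩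
    {x | ∀ i ∈ W, listBase (H i) + Φ.topSwitching B i ≤ x}

/-- `p̄(m') = ∑_B μ(∅, B) ∏_{W ∈ π(B)} (∏_k q̄_k(B, W) - |gaps on W|)`. -/
noncomputable def pBar {V E : Type*} {d : ℕ} [Fintype V] [Finite E]
    (Φ : GainGraph V E (Fin d → ℤ)) (H : V → Set (Fin d → ℤ)) (m' : Fin d → ℤ) : ℤ :=
  ∑ B : Φ.LatB, Φ.muEmpty B *
    ∏ W ∈ Φ.parts B.1, ((∏ k, Φ.qBar H B.1 W m' k) - ((Φ.gapsOn H B.1 W).ncard : ℤ))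

end GainGraph

/-!
The edges on which a coloration `x` is improper form a closed balanced set, because `-x` switches
all their gains to `0`. Möbius inversion over `LatB` therefore expresses the number of proper
colorations through the numbers of list colorations that are improper on every edge of `B`. These
are the potentials on `B` with values in the lists, and the potentials on `B` are the functions
`v ↦ y W - η_B v`, `v ∈ W ∈ π(B)`, with one free vector `y W` for each part. So the count is a
product over `π(B)`, whose factor at `W` is the number of points of the contracted color list of `W`
below `m'`: a box minus finitely many gaps.

The switching function `η_B` is bounded by the joins of path gains, so a bound `m'` above
`listHat (H j) + pathGainSup j` for all `j` makes every `qBar` nonnegative, hence the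
true number of points on a side of the box, and puts all the gaps inside the box. Without balanced
loops, every nonempty `B` has fewer parts than `V` has elements, so only `B = ∅` contributes to the
leading term.
-/

namespace GainGraph

section Walks

variable {V E G : Type*} [AddCommGroup G] {Φ : GainGraph V E G}

theorem Traverses.symm {e : E} {u v : V} {g : G} (h : Φ.Traverses e u v g) :
    Φ.Traverses e v u (-g) := by
  cases h with
  | fwd h => exact .bwd h
  | bwd h => rw [neg_neg]; exact .fwd h

theorem Traverses.eq_or_eq {e : E} {u v u' v' : V} {g g' : G} (h : Φ.Traverses e u v g)
    (h' : Φ.Traverses e u' v' g') :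
    (u' = u ∧ v' = v ∧ g' = g) ∨ (u' = v ∧ v' = u ∧ g' = -g) := by
  rcases h with ⟨h⟩ | ⟨h⟩ <;> rcases h' with ⟨h'⟩ | ⟨h'⟩ <;> simp_all

namespace Walk

/-- Concatenation of walks. -/
def append : {u v w : V} → Walk Φ u v → Walk Φ v w → Walk Φ u w
  | _, _, _, nil _, q => q
  | _, _, _, cons e g h p, q => cons e g h (p.append q)

/-- The walk traversed backwards, with every gain negated. -/
def reverse : {u v : V} → Walk Φ u v → Walk Φ v u
  | _, _, nil v => nil v
  | _, _, cons e g h p => p.reverse.append (cons e (-g) h.symm (nil _))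

@[simp] theorem gain_append {u v w : V} (p : Walk Φ u v) (q : Walk Φ v w) :
    (p.append q).gain = p.gain + q.gain := by
  induction p with
  | nil => simp [append, gain]
  | cons e g h p ih => simp [append, gain, ih, add_assoc]

@[simp] theorem edges_append {u v w : V} (p : Walk Φ u v) (q : Walk Φ v w) :
    (p.append q).edges = p.edges ++ q.edges := by
  induction p with
  | nil => simp [append, edges]
  | cons e g h p ih => simp [append, edges, ih]

@[simp] theorem gain_reverse {u v : V} (p : Walk Φ u v) : p.reverse.gain = -p.gain := by
  induction p with
  | nil => simp [reverse, gain]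
  | cons e g h p ih => simp [reverse, gain, ih, add_comm]

@[simp] theorem mem_edges_reverse {u v : V} {p : Walk Φ u v} {e : E} :
    e ∈ p.reverse.edges ↔ e ∈ p.edges := by
  induction p with
  | nil => simp [reverse]
  | cons e g h p ih => simp [reverse, edges, ih, or_comm]

theorem start_mem_support {u v : V} (p : Walk Φ u v) : u ∈ p.support := by
  cases p <;> simp [support]

theorem end_mem_support {u v : V} (p : Walk Φ u v) : v ∈ p.support := by
  induction p with
  | nil => simp [support]
  | cons _ _ _ p ih => simp [support, ih]

theorem mem_support_of_mem_edges {u v : V} {p : Walk Φ u v} {e : E} (he : e ∈ p.edges)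
    {a b : V} {g : G} (h : Φ.Traverses e a b g) : a ∈ p.support := by
  induction p with
  | nil => simp [edges] at he
  | cons e' g' h' p ih =>
    rcases List.mem_cons.1 he with rfl | he
    · rcases h'.eq_or_eq h with ⟨rfl, -, -⟩ | ⟨rfl, -, -⟩
      · exact start_mem_support _
      · exact List.mem_cons_of_mem _ p.start_mem_support
    · exact List.mem_cons_of_mem _ (ih he)

theorem support_sublist_support_append_left {u v w : V} (p : Walk Φ u v) (q : Walk Φ v w) :
    p.support.Sublist (p.append q).support := by
  induction p with
  | nil => exact List.singleton_sublist.2 q.start_mem_support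
  | cons _ _ _ p ih => exact (ih q).cons_cons _

theorem support_sublist_support_append_right {u v w : V} (p : Walk Φ u v) (q : Walk Φ v w) :
    q.support.Sublist (p.append q).support := by
  induction p with
  | nil => exact List.Sublist.refl _
  | cons _ _ _ p ih => exact (ih q).cons _

theorem exists_append_eq_of_mem_support {u v w : V} {p : Walk Φ u w} (hv : v ∈ p.support) :
    ∃ (q : Walk Φ u v) (r : Walk Φ v w), q.append r = p := by
  induction p with
  | nil x =>
    obtain rfl : v = x := List.mem_singleton.1 hv
    exact ⟨nil v, nil v, rfl⟩
  | @cons a b c e g h p ih =>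
    rcases List.mem_cons.1 hv with rfl | hv
    · exact ⟨nil v, cons e g h p, rfl⟩
    · obtain ⟨q, r, rfl⟩ := ih hv
      exact ⟨cons e g h q, r, rfl⟩

section InSet

variable {S : Finset E}

@[simp] theorem inSet_nil (v : V) : (nil v : Walk Φ v v).InSet S := by
  simp [InSet, edges]

@[simp] theorem inSet_cons {u v w : V} {e : E} {g : G} {h : Φ.Traverses e u v g}
    {p : Walk Φ v w} : (cons e g h p).InSet S ↔ e ∈ S ∧ p.InSet S := by
  simp [InSet, edges]

@[simp] theorem inSet_append {u v w : V} {p : Walk Φ u v} {q : Walk Φ v w} :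
    (p.append q).InSet S ↔ p.InSet S ∧ q.InSet S := by
  simp [InSet, or_imp, forall_and]

@[simp] theorem inSet_reverse {u v : V} {p : Walk Φ u v} : p.reverse.InSet S ↔ p.InSet S := by
  simp [InSet]

end InSet

theorem isPath_nil (v : V) : (nil v : Walk Φ v v).IsPath :=
  List.nodup_singleton v

theorem isPath_cons {u v w : V} {e : E} {g : G} {h : Φ.Traverses e u v g} {p : Walk Φ v w} :
    (cons e g h p).IsPath ↔ u ∉ p.support ∧ p.IsPath :=
  List.nodup_cons

theorem IsPath.edges_nodup {u v : V} {p : Walk Φ u v} (hp : p.IsPath) : p.edges.Nodup := by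
  induction p with
  | nil => exact List.nodup_nil
  | cons e g h p ih =>
    obtain ⟨hu, hp⟩ := isPath_cons.1 hp
    exact List.nodup_cons.2 ⟨fun he => hu (mem_support_of_mem_edges he h), ih hp⟩

theorem IsPath.gain_eq_zero {u : V} {p : Walk Φ u u} (hp : p.IsPath) : p.gain = 0 := by
  cases p with
  | nil => rfl
  | cons e g h p => exact absurd p.end_mem_support (isPath_cons.1 hp).1

end Walk

end Walks

section Balance

variable {V E G : Type*} [AddCommGroup G] {Φ : GainGraph V E G} {S : Finset E}

namespace Balanced

-- The closed walk is a circle, unless the path runs back along the edge itself.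
theorem add_gain_eq_zero (hS : Φ.Balanced S) {u v : V} {e : E} {g : G}
    (h : Φ.Traverses e u v g) (he : e ∈ S) {q : Walk Φ v u} (hq : q.IsPath) (hqS : q.InSet S) :
    g + q.gain = 0 := by
  by_cases heq : e ∈ q.edges
  · cases q with
    | nil => simp [Walk.edges] at heq
    | cons e' g' h' q =>
      obtain ⟨hv, hq'⟩ := Walk.isPath_cons.1 hq
      rcases List.mem_cons.1 heq with rfl | heq
      · rcases h.eq_or_eq h' with ⟨rfl, rfl, -⟩ | ⟨-, rfl, rfl⟩
        · exact absurd q.start_mem_support hv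
        · simp [Walk.gain, hq'.gain_eq_zero]
      · exact absurd (Walk.mem_support_of_mem_edges heq h.symm) hv
  · exact hS.2 u (.cons e g h q)
      ⟨List.cons_ne_nil _ _, List.nodup_cons.2 ⟨heq, hq.edges_nodup⟩, hq⟩
      (Walk.inSet_cons.2 ⟨he, hqS⟩)

theorem exists_isPath_gain_eq (hS : Φ.Balanced S) {u v : V} {p : Walk Φ u v} (hp : p.InSet S) :
    ∃ q : Walk Φ u v, q.IsPath ∧ q.InSet S ∧ q.gain = p.gain := by
  induction p with
  | nil x => exact ⟨.nil x, Walk.isPath_nil x, hp, rfl⟩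
  | @cons a b c e g h p ih =>
    obtain ⟨he, hp⟩ := Walk.inSet_cons.1 hp
    obtain ⟨q, hq, hqS, hgain⟩ := ih hp
    by_cases ha : a ∈ q.support
    · obtain ⟨q₁, q₂, rfl⟩ := Walk.exists_append_eq_of_mem_support ha
      obtain ⟨hq₁S, hq₂S⟩ := Walk.inSet_append.1 hqS
      have hq₁ : q₁.IsPath := hq.sublist (q₁.support_sublist_support_append_left q₂)
      refine ⟨q₂, hq.sublist (q₁.support_sublist_support_append_right q₂), hq₂S, ?_⟩
      rw [Walk.gain, ← hgain, Walk.gain_append, ← add_assoc, hS.add_gain_eq_zero h he hq₁ hq₁S,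
        zero_add]
    · exact ⟨.cons e g h q, Walk.isPath_cons.2 ⟨ha, hq⟩, Walk.inSet_cons.2 ⟨he, hqS⟩,
        congrArg (g + ·) hgain⟩

theorem gain_eq_gain (hS : Φ.Balanced S) {u v : V} {p q : Walk Φ u v} (hp : p.InSet S)
    (hq : q.InSet S) : p.gain = q.gain := by
  obtain ⟨r, hr, -, hgain⟩ :=
    hS.exists_isPath_gain_eq (p := p.append q.reverse) (by simp [hp, hq])
  rw [hr.gain_eq_zero, Walk.gain_append, Walk.gain_reverse, ← sub_eq_add_neg] at hgain
  exact sub_eq_zero.1 hgain.symm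

theorem exists_traverses (hS : Φ.Balanced S) (hloose : ∀ e : E, Φ.kind e ≠ EdgeKind.loose) {e : E}
    (he : e ∈ S) : ∃ u v g, Φ.Traverses e u v g := by
  cases h : Φ.kind e with
  | ordinary u v g => exact ⟨u, v, g, .fwd h⟩
  | half v => exact absurd h (hS.1 e he v)
  | loose => exact absurd h (hloose e)

end Balanced

theorem balanced_empty : Φ.Balanced ∅ := by
  refine ⟨by simp, fun v p hc hp => absurd ?_ hc.1⟩
  exact List.eq_nil_iff_forall_not_mem.2 fun e he => Finset.notMem_empty e (hp e he)

theorem closed_empty (hloop : ∀ (e : E) (v : V), ¬ Φ.Traverses e v v 0)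
    (hloose : ∀ e : E, Φ.kind e ≠ EdgeKind.loose) : Φ.Closed ∅ := by
  refine ⟨?_, fun e he => absurd he (hloose e)⟩
  rintro e u v g h ⟨p, -, hp, rfl⟩
  cases p with
  | nil => exact absurd h (hloop e u)
  | cons e' g h' p => exact absurd (Walk.inSet_cons.1 hp).1 (Finset.notMem_empty e')

end Balance

section Components

variable {V E G : Type*} [AddCommGroup G] (Φ : GainGraph V E G) (S : Finset E)

/-- The equivalence relation of being joined by a walk in `S`. Unlike `component`, it makes sense
for infinite `V`. -/
def joined : Setoid V where
  r u v := ∃ p : Walk Φ u v, p.InSet S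
  iseqv :=
    { refl := fun v => ⟨.nil v, Walk.inSet_nil v⟩
      symm := fun ⟨p, hp⟩ => ⟨p.reverse, Walk.inSet_reverse.2 hp⟩
      trans := fun ⟨p, hp⟩ ⟨q, hq⟩ => ⟨p.append q, Walk.inSet_append.2 ⟨hp, hq⟩⟩ }

variable {Φ S}

theorem joined_of_traverses {e : E} (he : e ∈ S) {u v : V} {g : G} (h : Φ.Traverses e u v g) :
    Φ.joined S u v :=
  ⟨.cons e g h (.nil v), by simp [he]⟩

variable [Fintype V]

theorem mem_component {v w : V} : w ∈ Φ.component S v ↔ Φ.joined S v w := by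
  simp only [component, Finset.mem_filter, Finset.mem_univ, true_and]
  rfl

theorem self_mem_component (v : V) : v ∈ Φ.component S v :=
  mem_component.2 ((Φ.joined S).refl v)

theorem component_eq_component_iff {v w : V} :
    Φ.component S v = Φ.component S w ↔ Φ.joined S v w := by
  refine ⟨fun h => mem_component.1 (h ▸ self_mem_component w), fun h => ?_⟩
  ext x
  rw [mem_component, mem_component]
  exact ⟨(Φ.joined S).trans ((Φ.joined S).symm h), (Φ.joined S).trans h⟩

theorem mem_parts {W : Finset V} : W ∈ Φ.parts S ↔ ∃ v, Φ.component S v = W := by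
  simp [parts]

theorem nonempty_of_mem_parts {W : Finset V} (hW : W ∈ Φ.parts S) : W.Nonempty := by
  obtain ⟨w, rfl⟩ := mem_parts.1 hW
  exact ⟨w, self_mem_component w⟩

variable (Φ S) in
/-- The component of `v`, as a member of the partition `π(S)`. -/
noncomputable def part (v : V) : Φ.parts S :=
  ⟨Φ.component S v, mem_parts.2 ⟨v, rfl⟩⟩

theorem mem_part (v : V) : v ∈ (Φ.part S v).1 :=
  self_mem_component v

theorem part_eq_part_iff {v w : V} : Φ.part S v = Φ.part S w ↔ Φ.joined S v w :=
  Subtype.ext_iff.trans component_eq_component_iff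

theorem mem_iff_part_eq {W : Φ.parts S} {v : V} : v ∈ W.1 ↔ Φ.part S v = W := by
  refine ⟨fun hv => Subtype.ext ?_, fun h => h ▸ mem_part v⟩
  obtain ⟨w, hw⟩ := mem_parts.1 W.2
  rw [← hw] at hv ⊢
  exact component_eq_component_iff.2 ((Φ.joined S).symm (mem_component.1 hv))

theorem card_parts_le : (Φ.parts S).card ≤ Fintype.card V := by
  classical exact Finset.card_image_le

theorem parts_empty : Φ.parts ∅ = Finset.univ.map ⟨singleton, Finset.singleton_injective⟩ := by
  have hcomponent (v : V) : Φ.component ∅ v = {v} := by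
    ext w
    rw [mem_component, Finset.mem_singleton]
    constructor
    · rintro ⟨p, hp⟩
      cases p with
      | nil => rfl
      | cons e g h p => exact absurd (Walk.inSet_cons.1 hp).1 (Finset.notMem_empty e)
    · rintro rfl
      exact (Φ.joined ∅).refl w
  ext W
  simp [mem_parts, hcomponent]

theorem card_parts_empty : (Φ.parts ∅).card = Fintype.card V := by
  rw [parts_empty, Finset.card_map, Finset.card_univ]

theorem card_parts_lt {e : E} (he : e ∈ S) {u v : V} {g : G} (h : Φ.Traverses e u v g)
    (huv : u ≠ v) : (Φ.parts S).card < Fintype.card V := by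
  classical
  refine card_parts_le.lt_of_ne fun hcard => huv ?_
  have hinj : Set.InjOn (Φ.component S) (Finset.univ : Finset V) :=
    Finset.card_image_iff.1 (by rw [Finset.card_univ, ← hcard, parts])
  exact hinj (by simp) (by simp) (component_eq_component_iff.2 (joined_of_traverses he h))

end Components

section Potentials

variable {V E G : Type*} [AddCommGroup G] {Φ : GainGraph V E G} {S T : Finset E} {θ : V → G}

/-- A potential on `S` is a coloration for which no edge of `S` is properly colored. Potentials on
`S` are the negatives of the functions that switch all gains in `S` to `0`. -/
def IsPotential (Φ : GainGraph V E G) (S : Finset E) (θ : V → G) : Prop :=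
  ∀ e ∈ S, ∀ (u v : V) (g : G), Φ.Traverses e u v g → θ v = θ u + g

theorem IsPotential.mono (hST : S ⊆ T) (hθ : Φ.IsPotential T θ) : Φ.IsPotential S θ :=
  fun e he => hθ e (hST he)

theorem IsPotential.apply_end_eq (hθ : Φ.IsPotential S θ) {u v : V} (p : Walk Φ u v)
    (hp : p.InSet S) : θ v = θ u + p.gain := by
  induction p with
  | nil => simp [Walk.gain]
  | cons e g h p ih =>
    obtain ⟨he, hp⟩ := Walk.inSet_cons.1 hp
    rw [ih hp, hθ e he _ _ _ h, Walk.gain, add_assoc]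

theorem IsPotential.sub_eq_sub {θ' : V → G} (hθ : Φ.IsPotential S θ) (hθ' : Φ.IsPotential S θ')
    {u v : V} (huv : Φ.joined S u v) : θ u - θ' u = θ v - θ' v := by
  obtain ⟨p, hp⟩ := huv
  rw [hθ.apply_end_eq p hp, hθ'.apply_end_eq p hp, add_sub_add_right_eq_sub]

theorem Balanced.exists_isPotential (hS : Φ.Balanced S) : ∃ θ, Φ.IsPotential S θ := by
  let root (v : V) : V := (Quotient.mk (Φ.joined S) v).out
  choose p hp using fun v => Quotient.mk_out (s := Φ.joined S) v
  refine ⟨fun v => (p v).gain, fun e he u v g h => ?_⟩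
  have hroot : root v = root u :=
    congrArg Quotient.out (Quotient.sound ((Φ.joined S).symm (joined_of_traverses he h)))
  have gain_eq {x : V} (hx : x = root u) (q : Walk Φ x v) (hq : q.InSet S) :
      q.gain = (p u).gain + g := by
    subst hx
    rw [hS.gain_eq_gain (q := (p u).append (.cons e g h (.nil v))) hq (by simp [he, hp u])]
    simp [Walk.gain]
  exact gain_eq hroot (p v) (hp v)

theorem Balanced.ne_of_traverses (hS : Φ.Balanced S)
    (hloop : ∀ (e : E) (v : V), ¬ Φ.Traverses e v v 0) {e : E} (he : e ∈ S) {u v : V} {g : G}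
    (h : Φ.Traverses e u v g) : u ≠ v := by
  rintro rfl
  obtain ⟨θ, hθ⟩ := hS.exists_isPotential
  obtain rfl : g = 0 := left_eq_add.1 (hθ e he u u g h)
  exact hloop e u h

section Translate

variable [Fintype V]

/-- The function `θ` translated by `y W` on each component `W` of `S`. -/
noncomputable def translate (Φ : GainGraph V E G) (S : Finset E) (θ : V → G)
    (y : Φ.parts S → G) (v : V) : G :=
  y (Φ.part S v) + θ v

theorem translate_injective : Function.Injective (Φ.translate S θ) := by
  intro y z h
  funext W
  obtain ⟨v, hv⟩ := nonempty_of_mem_parts W.2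
  simpa [translate, mem_iff_part_eq.1 hv] using congrFun h v

theorem IsPotential.translate (hθ : Φ.IsPotential S θ) (y : Φ.parts S → G) :
    Φ.IsPotential S (Φ.translate S θ y) := by
  intro e he u v g h
  have hpart := part_eq_part_iff.2 (joined_of_traverses he h)
  rw [GainGraph.translate, GainGraph.translate, hpart, hθ e he u v g h, add_assoc]

theorem IsPotential.range_translate (hθ : Φ.IsPotential S θ) :
    Set.range (Φ.translate S θ) = {x | Φ.IsPotential S x} := by
  refine Set.Subset.antisymm (Set.range_subset_iff.2 hθ.translate) fun x hx => ?_
  choose r hr using fun W : Φ.parts S => nonempty_of_mem_parts W.2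
  refine ⟨fun W => x (r W) - θ (r W), funext fun v => ?_⟩
  have hv : Φ.joined S (r (Φ.part S v)) v := part_eq_part_iff.1 (mem_iff_part_eq.1 (hr _))
  rw [GainGraph.translate, IsPotential.sub_eq_sub hx hθ hv, sub_add_cancel]

end Translate

end Potentials

section ImproperEdges

variable {V E G : Type*} [AddCommGroup G] [Finite E]

/-- The set of edges that are not properly colored by `x`. -/
noncomputable def improperEdges (Φ : GainGraph V E G) (x : V → G) : Finset E :=
  (Set.toFinite {e | ∃ i j g, Φ.Traverses e i j g ∧ x j = x i + g}).toFinset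

variable {Φ : GainGraph V E G} {S : Finset E} {x : V → G}

theorem mem_improperEdges {e : E} :
    e ∈ Φ.improperEdges x ↔ ∃ i j g, Φ.Traverses e i j g ∧ x j = x i + g := by
  simp [improperEdges]

theorem isPotential_improperEdges (x : V → G) : Φ.IsPotential (Φ.improperEdges x) x := by
  intro e he u v g h
  obtain ⟨i, j, g', h', hx⟩ := mem_improperEdges.1 he
  rcases h.eq_or_eq h' with ⟨rfl, rfl, rfl⟩ | ⟨rfl, rfl, rfl⟩
  · exact hx
  · rw [hx, neg_add_cancel_right]

theorem subset_improperEdges_iff (hS : ∀ e ∈ S, ∃ u v g, Φ.Traverses e u v g) :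
    S ⊆ Φ.improperEdges x ↔ Φ.IsPotential S x := by
  refine ⟨fun h => (isPotential_improperEdges x).mono h, fun h e he => ?_⟩
  obtain ⟨u, v, g, huv⟩ := hS e he
  exact mem_improperEdges.2 ⟨u, v, g, huv, h e he u v g huv⟩

theorem balanced_improperEdges (x : V → G) : Φ.Balanced (Φ.improperEdges x) := by
  refine ⟨fun e he v h => ?_, fun v p _ hp => ?_⟩
  · obtain ⟨i, j, g, ⟨h'⟩ | ⟨h'⟩, -⟩ := mem_improperEdges.1 he <;> simp [h] at h'
  · exact left_eq_add.1 ((isPotential_improperEdges x).apply_end_eq p hp)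

theorem closed_improperEdges (hloose : ∀ e : E, Φ.kind e ≠ EdgeKind.loose) (x : V → G) :
    Φ.Closed (Φ.improperEdges x) := by
  refine ⟨?_, fun e he => absurd he (hloose e)⟩
  rintro e u v g h ⟨p, -, hp, rfl⟩
  exact mem_improperEdges.2 ⟨u, v, _, h, (isPotential_improperEdges x).apply_end_eq p hp⟩

end ImproperEdges

section TopSwitching

variable {V E G : Type*} [Fintype V] [AddCommGroup G] [Lattice G] [IsOrderedAddMonoid G]
  {Φ : GainGraph V E G} {S : Finset E}

theorem Balanced.exists_isTopSwitching (hS : Φ.Balanced S) : ∃ η, Φ.IsTopSwitching S η := by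
  obtain ⟨θ, hθ⟩ := hS.exists_isPotential
  let meet (W : Φ.parts S) : G := W.1.inf' (nonempty_of_mem_parts W.2) (-θ)
  refine ⟨-Φ.translate S θ meet, fun e he u v g h => ?_, fun W hW => ⟨?_, fun b hb => ?_⟩⟩
  · rw [Pi.neg_apply, Pi.neg_apply, neg_neg, hθ.translate meet e he u v g h, add_neg_cancel]
  · rintro _ ⟨v, -, rfl⟩
    rw [Pi.neg_apply, translate, neg_add', sub_nonneg, le_neg]
    exact Finset.inf'_le (-θ) (mem_part v)
  · suffices h : b + meet ⟨W, hW⟩ ≤ meet ⟨W, hW⟩ from add_le_iff_nonpos_left.1 h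
    refine Finset.le_inf' _ _ fun v hv => ?_
    have hbv : b ≤ -(Φ.translate S θ meet v) := hb ⟨v, hv, rfl⟩
    rwa [translate, mem_iff_part_eq (W := ⟨W, hW⟩).1 hv, neg_add_rev, ← sub_eq_add_neg,
      le_sub_iff_add_le] at hbv

namespace Balanced

theorem isTopSwitching_topSwitching (hS : Φ.Balanced S) :
    Φ.IsTopSwitching S (Φ.topSwitching S) :=
  Classical.epsilon_spec hS.exists_isTopSwitching

theorem isPotential_neg_topSwitching (hS : Φ.Balanced S) :
    Φ.IsPotential S (-Φ.topSwitching S) := fun e he u v g h =>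
  (eq_neg_of_add_eq_zero_left (hS.isTopSwitching_topSwitching.1 e he u v g h)).symm

theorem forall_sub_topSwitching_le_iff (hS : Φ.Balanced S) {W : Finset V} (hW : W ∈ Φ.parts S)
    {y z : G} : (∀ i ∈ W, y - Φ.topSwitching S i ≤ z) ↔ y ≤ z := by
  rw [← sub_nonpos (a := y), le_isGLB_iff (hS.isTopSwitching_topSwitching.2 W hW)]
  simp [mem_lowerBounds, add_comm z]

end Balanced

end TopSwitching

section PathGains

variable {V E G : Type*} [AddCommGroup G] [Finite E]

theorem finite_gains (Φ : GainGraph V E G) : {g | ∃ e u v, Φ.Traverses e u v g}.Finite := by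
  rw [Set.ofPred_exists]
  refine Set.finite_iUnion fun e => ?_
  rcases Set.eq_empty_or_nonempty {g | ∃ u v, Φ.Traverses e u v g} with h | ⟨g, u, v, h⟩
  · exact h ▸ Set.finite_empty
  · refine (Set.toFinite {g, -g}).subset ?_
    rintro g' ⟨u', v', h'⟩
    rcases h.eq_or_eq h' with ⟨-, -, rfl⟩ | ⟨-, -, rfl⟩ <;> simp

theorem bddAbove_pathGains [Finite V] [Lattice G] [IsOrderedAddMonoid G] (Φ : GainGraph V E G)
    (v : V) : BddAbove {g | ∃ (w : V) (p : Walk Φ v w), p.IsPath ∧ p.gain = g} := by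
  have := Fintype.ofFinite V
  obtain ⟨b, hb⟩ := Φ.finite_gains.bddAbove
  have gain_le {u w : V} (p : Walk Φ u w) : p.gain ≤ p.support.length • (b ⊔ 0) := by
    induction p with
    | nil => simp [Walk.gain, Walk.support]
    | cons e g h p ih =>
      rw [Walk.gain, Walk.support, List.length_cons, succ_nsmul']
      exact add_le_add (le_sup_of_le_left (hb ⟨e, _, _, h⟩)) ih
  refine ⟨Fintype.card V • (b ⊔ 0), ?_⟩
  rintro _ ⟨w, p, hp, rfl⟩
  exact (gain_le p).trans (nsmul_le_nsmul_left le_sup_right (List.Nodup.length_le_card hp))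

variable {d : ℕ} {Φ : GainGraph V E (Fin d → ℤ)}

theorem Walk.IsPath.gain_le_pathGainSup [Finite V] {v w : V} {p : Walk Φ v w} (hp : p.IsPath) :
    p.gain ≤ Φ.pathGainSup v :=
  le_csSup (Φ.bddAbove_pathGains v) ⟨w, p, hp, rfl⟩

theorem Balanced.topSwitching_le_pathGainSup [Fintype V] {S : Finset E} (hS : Φ.Balanced S)
    (v : V) : Φ.topSwitching S v ≤ Φ.pathGainSup v := by
  refine (hS.forall_sub_topSwitching_le_iff (Φ.part S v).2).1 fun w hw => ?_
  obtain ⟨p, hp⟩ := mem_component.1 hw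
  obtain ⟨q, hq, hqS, -⟩ := hS.exists_isPath_gain_eq hp
  have hgain := hS.isPotential_neg_topSwitching.apply_end_eq q hqS
  rw [Pi.neg_apply, Pi.neg_apply, eq_neg_add_iff_add_eq, ← sub_eq_add_neg] at hgain
  exact hgain.trans_le hq.gain_le_pathGainSup

end PathGains

end GainGraph

section Lists

variable {d : ℕ} {H : Set (Fin d → ℤ)} {x : Fin d → ℤ}

theorem IsW2.listBase_le (hH : IsW2 H) (hx : x ∈ H) : listBase H ≤ x :=
  csInf_le hH.1 hx

theorem IsW2.mem_iff (hH : IsW2 H) : x ∈ H ↔ listBase H ≤ x ∧ x ∉ listGaps H :=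
  ⟨fun hx => ⟨hH.listBase_le hx, fun h => h.2 hx⟩,
    fun ⟨hbase, hgap⟩ => by_contra fun hx => hgap ⟨hbase, hx⟩⟩

theorem IsW2.finite_listGaps (hH : IsW2 H) : (listGaps H).Finite := by
  rcases isEmpty_or_nonempty (Fin d) with _ | _
  · exact Set.toFinite _
  obtain ⟨-, a, A, hA, -, rfl⟩ := hH
  have hne : (Set.Ici a \ A).Nonempty := ((Set.Ici_infinite a).sdiff hA).nonempty
  have ha : a ≤ listBase (Set.Ici a \ A) := le_csInf hne fun y hy => hy.1
  exact hA.subset fun x ⟨hx, hxH⟩ => by_contra fun hxA => hxH ⟨ha.trans hx, hxA⟩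

theorem IsW2.le_listHat (hH : IsW2 H) (hx : x ∈ listGaps H) : x ≤ listHat H := by
  rw [listHat, if_neg (Set.nonempty_iff_ne_empty.1 ⟨x, hx⟩)]
  exact le_csSup hH.finite_listGaps.bddAbove hx

theorem IsW2.listBase_le_listHat_add_one (hH : IsW2 H) : listBase H ≤ listHat H + 1 := by
  by_cases h : listGaps H = ∅
  · rw [listHat, if_pos h, sub_add_cancel]
  · obtain ⟨x, hx⟩ := Set.nonempty_iff_ne_empty.2 h
    exact (hx.1.trans (hH.le_listHat hx)).trans (le_add_of_nonneg_right zero_le_one)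

end Lists

section Counting

theorem ncard_Icc_sdiff {ι : Type*} [Fintype ι] {a b : ι → ℤ} (hab : a ≤ b + 1)
    {s : Set (ι → ℤ)} (hs : s ⊆ Set.Icc a b) :
    ((Set.Icc a b \ s).ncard : ℤ) = (∏ k, (b k + 1 - a k)) - s.ncard := by
  classical
  have hcard : ((Set.Icc a b).ncard : ℤ) = ∏ k, (b k + 1 - a k) := by
    rw [← Finset.coe_Icc, Set.ncard_coe_finset, Pi.card_Icc, Nat.cast_prod]
    exact Finset.prod_congr rfl fun k _ => Int.card_Icc_of_le _ _ (hab k)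
  rw [eq_sub_iff_add_eq, ← hcard, ← Set.ncard_sdiff_add_ncard_of_subset hs, Nat.cast_add]

theorem ncard_univ_pi {ι : Type*} [Fintype ι] {α : ι → Type*} (s : ∀ i, Set (α i)) :
    (Set.univ.pi s).ncard = ∏ i, (s i).ncard := by
  rw [Set.ncard, Set.encard_pi_eq_prod_encard, ENat.toNat_prod]
  rfl

theorem ncard_fiber_eq_sum_mu {ι α 𝕜 : Type*} [Ring 𝕜] [Fintype α] [PartialOrder α]
    [LocallyFiniteOrder α] [DecidableEq α] {s : Set ι} (hs : s.Finite) (f : ι → α) (a : α) :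
    ({i ∈ s | f i = a}.ncard : 𝕜) =
      ∑ b, IncidenceAlgebra.mu 𝕜 a b * {i ∈ s | b ≤ f i}.ncard := by
  classical
  lift s to Finset ι using hs
  have ncard_eq_sum (p : ι → Prop) [DecidablePred p] :
      ({i ∈ (s : Set ι) | p i}.ncard : 𝕜) = ∑ i ∈ s, if p i then 1 else 0 := by
    rw [Finset.sum_boole, ← Set.ncard_coe_finset, Finset.coe_filter]
    rfl
  have sum_mu (c : α) :
      ∑ b, IncidenceAlgebra.mu 𝕜 a b * (if b ≤ c then 1 else 0) = if c = a then 1 else 0 := by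
    simp only [mul_ite, mul_one, mul_zero, ← Finset.sum_filter, eq_comm (a := c)]
    rw [← IncidenceAlgebra.sum_Icc_mu_right]
    refine (Finset.sum_subset (fun b hb => ?_) fun b hb hb' => ?_).symm
    · simpa using (Finset.mem_Icc.1 hb).2
    · refine IncidenceAlgebra.apply_eq_zero_of_not_le (fun hab => hb' ?_) _
      exact Finset.mem_Icc.2 ⟨hab, by simpa using hb⟩
  simp only [ncard_eq_sum, Finset.mul_sum]
  rw [Finset.sum_comm]
  simp only [sum_mu]

end Counting

namespace GainGraph

section ListColorations

variable {V E : Type*} {d : ℕ} {Φ : GainGraph V E (Fin d → ℤ)} {H : V → Set (Fin d → ℤ)}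

/-- The colorations from the lists `H` with upper bounds `m`, proper or not. -/
def listColorations (H : V → Set (Fin d → ℤ)) (m : V → Fin d → ℤ) : Set (V → Fin d → ℤ) :=
  {x | (∀ i, x i ∈ H i) ∧ x ≤ m}

theorem finite_listColorations [Finite V] (hH : ∀ i, IsW2 (H i)) (m : V → Fin d → ℤ) :
    (listColorations H m).Finite := by
  classical
  have := Fintype.ofFinite V
  exact (Set.finite_Icc (fun i => listBase (H i)) m).subset
    fun x ⟨hx, hxm⟩ => ⟨fun i => (hH i).listBase_le (hx i), hxm⟩

theorem properColorations_subset (m : V → Fin d → ℤ) :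
    Φ.properColorations H m ⊆ listColorations H m :=
  fun _ hx => ⟨hx.1, hx.2.1⟩

theorem properColorations_eq [Finite E] (m : V → Fin d → ℤ) :
    Φ.properColorations H m = {x ∈ listColorations H m | Φ.improperEdges x = ∅} := by
  ext x
  simp only [properColorations, listColorations, Set.mem_ofPred_eq, and_assoc,
    Finset.eq_empty_iff_forall_notMem, mem_improperEdges, not_exists, not_and, ne_eq]

end ListColorations

section ContractedLists

variable {V E : Type*} [Fintype V] {d : ℕ} (Φ : GainGraph V E (Fin d → ℤ))
  (H : V → Set (Fin d → ℤ)) (B : Finset E) (W : Finset V)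

/-- The color list of the vertex `W` of the contraction of the switched gain graph by `B`: a color
`y` of `W` stands for the color `y - η_B(i)` of each `i ∈ W`. -/
def contractedList : Set (Fin d → ℤ) :=
  {y | ∀ i ∈ W, y - Φ.topSwitching B i ∈ H i}

/-- The least element of the contracted cone `{y | ∀ i ∈ W, h_i + η_B(i) ≤ y}`, in the form in which
it occurs in `qBar`. -/
noncomputable def partBase (k : Fin d) : ℤ :=
  sSup ((fun p : V × V =>
      listBase (H p.1) k + Φ.topSwitching B p.1 k - Φ.topSwitching B p.2 k) ''
    ((W : Set V) ×ˢ (W : Set V)))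

theorem qBar_eq (m : Fin d → ℤ) (k : Fin d) :
    Φ.qBar H B W m k = m k + 1 - Φ.partBase H B W k :=
  sub_add_eq_add_sub _ _ _

variable {Φ H B W}

theorem mem_gapsOn {y : Fin d → ℤ} :
    y ∈ Φ.gapsOn H B W ↔ (∃ i ∈ W, y - Φ.topSwitching B i ∈ listGaps (H i)) ∧
      ∀ i ∈ W, listBase (H i) + Φ.topSwitching B i ≤ y := by
  simp [gapsOn, sub_eq_add_neg]

theorem partBase_le_iff (hB : Φ.Balanced B) (hW : W ∈ Φ.parts B) {y : Fin d → ℤ} :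
    Φ.partBase H B W ≤ y ↔ ∀ i ∈ W, listBase (H i) + Φ.topSwitching B i ≤ y := by
  have hne := (nonempty_of_mem_parts hW).to_set
  calc Φ.partBase H B W ≤ y
    _ ↔ ∀ i ∈ W, ∀ j ∈ W, listBase (H i) + Φ.topSwitching B i - Φ.topSwitching B j ≤ y := by
      simp only [Pi.le_def, partBase]
      rw [forall_congr' fun k => csSup_le_iff (((W.finite_toSet.prod W.finite_toSet).image
        _).bddAbove) ((hne.prod hne).image _)]
      simp only [Set.forall_mem_image]
      exact ⟨fun h i hi j hj k => h k (x := (i, j)) ⟨hi, hj⟩, fun h k p hp => h _ hp.1 _ hp.2 k⟩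
    _ ↔ ∀ i ∈ W, listBase (H i) + Φ.topSwitching B i ≤ y :=
      forall₂_congr fun i _ => hB.forall_sub_topSwitching_le_iff hW

theorem contractedList_eq (hH : ∀ i, IsW2 (H i)) (hB : Φ.Balanced B) (hW : W ∈ Φ.parts B) :
    Φ.contractedList H B W = Set.Ici (Φ.partBase H B W) \ Φ.gapsOn H B W := by
  ext y
  simp only [contractedList, Set.mem_ofPred_eq, (hH _).mem_iff, le_sub_iff_add_le, Set.mem_sdiff,
    Set.mem_Ici, partBase_le_iff hB hW, mem_gapsOn]
  grind

theorem translate_mem_listColorations_iff (hB : Φ.Balanced B) {m : Fin d → ℤ}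
    {y : Φ.parts B → Fin d → ℤ} :
    Φ.translate B (-Φ.topSwitching B) y ∈ listColorations H (fun _ => m) ↔
      ∀ W : Φ.parts B, y W ∈ Φ.contractedList H B W.1 ∩ Set.Iic m := by
  have htranslate (i : V) :
      Φ.translate B (-Φ.topSwitching B) y i = y (Φ.part B i) - Φ.topSwitching B i :=
    (sub_eq_add_neg _ _).symm
  constructor
  · rintro ⟨hlist, hle⟩ W
    have hW {i : V} (hi : i ∈ W.1) :
        Φ.translate B (-Φ.topSwitching B) y i = y W - Φ.topSwitching B i := by
      rw [htranslate, mem_iff_part_eq.1 hi]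
    exact ⟨fun i hi => hW hi ▸ hlist i,
      (hB.forall_sub_topSwitching_le_iff W.2).1 fun i hi => hW hi ▸ hle i⟩
  · intro h
    refine ⟨fun i => htranslate i ▸ (h _).1 i (mem_part i), fun i => htranslate i ▸ ?_⟩
    exact (hB.forall_sub_topSwitching_le_iff (Φ.part B i).2).2 (h _).2 i (mem_part i)

variable [Finite E] {m : Fin d → ℤ}

theorem gapsOn_subset_Icc (hH : ∀ i, IsW2 (H i)) (hB : Φ.Balanced B) (hW : W ∈ Φ.parts B)
    (hm : ∀ j, listHat (H j) + Φ.pathGainSup j ≤ m) :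
    Φ.gapsOn H B W ⊆ Set.Icc (Φ.partBase H B W) m := by
  intro y hy
  obtain ⟨⟨i, -, hi⟩, hbase⟩ := mem_gapsOn.1 hy
  refine ⟨(partBase_le_iff hB hW).2 hbase, ?_⟩
  calc y ≤ listHat (H i) + Φ.topSwitching B i := sub_le_iff_le_add.1 ((hH i).le_listHat hi)
    _ ≤ listHat (H i) + Φ.pathGainSup i := add_le_add_right (hB.topSwitching_le_pathGainSup i) _
    _ ≤ m := hm i

theorem partBase_le_add_one (hH : ∀ i, IsW2 (H i)) (hB : Φ.Balanced B) (hW : W ∈ Φ.parts B)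
    (hm : ∀ j, listHat (H j) + Φ.pathGainSup j ≤ m) : Φ.partBase H B W ≤ m + 1 := by
  refine (partBase_le_iff hB hW).2 fun i _ => ?_
  calc listBase (H i) + Φ.topSwitching B i
    _ ≤ (listHat (H i) + 1) + Φ.pathGainSup i :=
      add_le_add (hH i).listBase_le_listHat_add_one (hB.topSwitching_le_pathGainSup i)
    _ = (listHat (H i) + Φ.pathGainSup i) + 1 := add_right_comm _ _ _
    _ ≤ m + 1 := add_le_add_left (hm i) 1

theorem ncard_contractedList_inter_Iic (hH : ∀ i, IsW2 (H i)) (hB : Φ.Balanced B)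
    (hW : W ∈ Φ.parts B) (hm : ∀ j, listHat (H j) + Φ.pathGainSup j ≤ m) :
    ((Φ.contractedList H B W ∩ Set.Iic m).ncard : ℤ) =
      (∏ k, Φ.qBar H B W m k) - (Φ.gapsOn H B W).ncard := by
  rw [contractedList_eq hH hB hW, Set.sdiff_inter_right_comm, Set.Ici_inter_Iic,
    ncard_Icc_sdiff (partBase_le_add_one hH hB hW hm) (gapsOn_subset_Icc hH hB hW hm)]
  simp only [qBar_eq]

theorem setOf_subset_improperEdges_eq_image (hB : Φ.Balanced B)
    (hloose : ∀ e : E, Φ.kind e ≠ EdgeKind.loose) :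
    {x ∈ listColorations H (fun _ => m) | B ⊆ Φ.improperEdges x} =
      Φ.translate B (-Φ.topSwitching B) ''
        Set.univ.pi fun W : Φ.parts B => Φ.contractedList H B W.1 ∩ Set.Iic m := by
  have hordinary (e : E) (he : e ∈ B) := hB.exists_traverses hloose he
  simp only [subset_improperEdges_iff hordinary, ← Set.inter_ofPred_eq_sep]
  rw [← hB.isPotential_neg_topSwitching.range_translate, ← Set.image_preimage_eq_inter_range]
  congr 1
  ext y
  exact (translate_mem_listColorations_iff hB).trans Set.mem_univ_pi.symm

theorem ncard_setOf_subset_improperEdges (hH : ∀ i, IsW2 (H i)) (hB : Φ.Balanced B)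
    (hloose : ∀ e : E, Φ.kind e ≠ EdgeKind.loose)
    (hm : ∀ j, listHat (H j) + Φ.pathGainSup j ≤ m) :
    ({x ∈ listColorations H (fun _ => m) | B ⊆ Φ.improperEdges x}.ncard : ℤ) =
      ∏ W ∈ Φ.parts B, ((∏ k, Φ.qBar H B W m k) - ((Φ.gapsOn H B W).ncard : ℤ)) := by
  rw [setOf_subset_improperEdges_eq_image hB hloose,
    Set.ncard_image_of_injective _ translate_injective, ncard_univ_pi, Nat.cast_prod,
    ← Finset.prod_coe_sort (Φ.parts B)]
  exact Finset.prod_congr rfl fun W _ => ncard_contractedList_inter_Iic hH hB W.2 hm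

end ContractedLists

section Moebius

variable {V E : Type*} [Finite E]

open Classical in
theorem muEmpty_eq {G : Type*} [AddCommGroup G] {Φ : GainGraph V E G}
    (h : Φ.Balanced ∅ ∧ Φ.Closed ∅) :
    letI : LocallyFiniteOrder Φ.LatB := Fintype.toLocallyFiniteOrder
    Φ.muEmpty = IncidenceAlgebra.mu ℤ (⟨∅, h⟩ : Φ.LatB) :=
  funext fun _ => dif_pos h

theorem muEmpty_empty {G : Type*} [AddCommGroup G] {Φ : GainGraph V E G}
    (h : Φ.Balanced ∅ ∧ Φ.Closed ∅) : Φ.muEmpty ⟨∅, h⟩ = 1 := by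
  classical
  let : LocallyFiniteOrder Φ.LatB := Fintype.toLocallyFiniteOrder
  rw [muEmpty_eq h, IncidenceAlgebra.mu_self]

variable [Fintype V] {d : ℕ} {Φ : GainGraph V E (Fin d → ℤ)} {H : V → Set (Fin d → ℤ)}

theorem chi_eq_pBar (hloop : ∀ (e : E) (v : V), ¬ Φ.Traverses e v v 0)
    (hloose : ∀ e : E, Φ.kind e ≠ EdgeKind.loose) (hH : ∀ i, IsW2 (H i)) {m : Fin d → ℤ}
    (hm : ∀ j, listHat (H j) + Φ.pathGainSup j ≤ m) :
    ((Φ.chi H fun _ => m : ℕ) : ℤ) = Φ.pBar H m := by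
  classical
  let : LocallyFiniteOrder Φ.LatB := Fintype.toLocallyFiniteOrder
  have hempty : Φ.Balanced ∅ ∧ Φ.Closed ∅ := ⟨balanced_empty, closed_empty hloop hloose⟩
  let improper (x : V → Fin d → ℤ) : Φ.LatB :=
    ⟨Φ.improperEdges x, balanced_improperEdges x, closed_improperEdges hloose x⟩
  calc ((Φ.chi H fun _ => m : ℕ) : ℤ)
    _ = ({x ∈ listColorations H (fun _ => m) | improper x = ⟨∅, hempty⟩}.ncard : ℤ) := by
      simp only [chi, properColorations_eq, improper, Subtype.mk.injEq]
    _ = ∑ B, Φ.muEmpty B * {x ∈ listColorations H (fun _ => m) | B ≤ improper x}.ncard := by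
      rw [ncard_fiber_eq_sum_mu (finite_listColorations hH _), muEmpty_eq hempty]
    _ = Φ.pBar H m := Finset.sum_congr rfl fun B _ =>
      congrArg _ (ncard_setOf_subset_improperEdges hH B.2.1 hloose hm)

end Moebius

end GainGraph

section BoxPolynomials

open MvPolynomial

theorem homogeneousComponent_mul_of_totalDegree_le {σ R : Type*} [CommSemiring R]
    {p q : MvPolynomial σ R} {a b : ℕ} (hp : p.totalDegree ≤ a) (hq : q.totalDegree ≤ b) :
    homogeneousComponent (a + b) (p * q) =
      homogeneousComponent a p * homogeneousComponent b q := by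
  classical
  ext m
  by_cases hm : m.degree = a + b
  · rw [coeff_homogeneousComponent, if_pos hm, coeff_mul, coeff_mul]
    refine Finset.sum_congr rfl fun ⟨i, j⟩ hij => ?_
    have hdeg : i.degree + j.degree = a + b := by
      rw [← hm, ← Finset.HasAntidiagonal.mem_antidiagonal.1 hij, map_add]
    have coeff_zero {r : MvPolynomial σ R} {c : ℕ} {l : σ →₀ ℕ} (hr : r.totalDegree ≤ c)
        (hl : c < l.degree) : coeff l r = 0 :=
      coeff_eq_zero_of_totalDegree_lt (hr.trans_lt hl)
    rw [coeff_homogeneousComponent, coeff_homogeneousComponent]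
    rcases lt_trichotomy i.degree a with hi | hi | hi
    · simp [coeff_zero hq (l := j) (by omega)]
    · simp [hi, show j.degree = b by omega]
    · simp [coeff_zero hp hi]
  · rw [coeff_homogeneousComponent, if_neg hm]
    exact (((homogeneousComponent_isHomogeneous a p).mul
      (homogeneousComponent_isHomogeneous b q)).coeff_eq_zero hm).symm

theorem homogeneousComponent_prod_of_totalDegree_le {ι σ R : Type*} [CommSemiring R]
    (s : Finset ι) {f : ι → MvPolynomial σ R} {n : ι → ℕ}
    (hf : ∀ i ∈ s, (f i).totalDegree ≤ n i) :
    homogeneousComponent (∑ i ∈ s, n i) (∏ i ∈ s, f i) =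
      ∏ i ∈ s, homogeneousComponent (n i) (f i) := by
  classical
  induction s using Finset.induction_on with
  | empty => simp
  | insert i s hi ih =>
    rw [Finset.forall_mem_insert] at hf
    rw [Finset.sum_insert hi, Finset.prod_insert hi, Finset.prod_insert hi, ← ih hf.2]
    exact homogeneousComponent_mul_of_totalDegree_le hf.1
      ((totalDegree_finsetProd s f).trans (Finset.sum_le_sum hf.2))

variable {σ R : Type*} [CommRing R]

theorem totalDegree_X_sub_C_le (k : σ) (c : R) : (X k - C c : MvPolynomial σ R).totalDegree ≤ 1 :=
  (totalDegree_sub_C_le _ _).trans (isHomogeneous_X R k).totalDegree_le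

variable [Fintype σ]

/-- The polynomial `∏ k, (X k - c k) - N`. For integers `c < m` its value at `m` is the number of
lattice points `y` with `c < y ≤ m`, with `N` of them removed. -/
noncomputable def boxPolynomial (c : σ → R) (N : R) : MvPolynomial σ R :=
  (∏ k, (X k - C (c k))) - C N

theorem eval_boxPolynomial (c m : σ → R) (N : R) :
    eval m (boxPolynomial c N) = (∏ k, (m k - c k)) - N := by
  simp [boxPolynomial]

theorem totalDegree_boxPolynomial_le (c : σ → R) (N : R) :
    (boxPolynomial c N).totalDegree ≤ Fintype.card σ :=
  calc (boxPolynomial c N).totalDegree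
    _ ≤ (∏ k, (X k - C (c k)) : MvPolynomial σ R).totalDegree := totalDegree_sub_C_le _ _
    _ ≤ ∑ k, (X k - C (c k) : MvPolynomial σ R).totalDegree := totalDegree_finsetProd _ _
    _ ≤ ∑ _k : σ, 1 := Finset.sum_le_sum fun k _ => totalDegree_X_sub_C_le k (c k)
    _ = Fintype.card σ := Fintype.card_eq_sum_ones.symm

theorem degreeOf_boxPolynomial_le [Nontrivial R] (c : σ → R) (N : R) (k : σ) :
    (boxPolynomial c N).degreeOf k ≤ 1 := by
  classical
  have degreeOf_factor_le (j : σ) : degreeOf k (X j - C (c j)) ≤ if k = j then 1 else 0 := by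
    refine (degreeOf_sub_le _ _ _).trans ?_
    rw [degreeOf_C, degreeOf_X, max_eq_left (Nat.zero_le _)]
  refine (degreeOf_sub_le _ _ _).trans (max_le ?_ ((degreeOf_C N k).trans_le zero_le_one))
  calc degreeOf k (∏ j, (X j - C (c j)))
    _ ≤ ∑ j, degreeOf k (X j - C (c j)) := degreeOf_prod_le _ _ _
    _ ≤ ∑ j, if k = j then 1 else 0 := Finset.sum_le_sum fun j _ => degreeOf_factor_le j
    _ = 1 := by simp

theorem homogeneousComponent_boxPolynomial [Nonempty σ] (c : σ → R) (N : R) :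
    homogeneousComponent (Fintype.card σ) (boxPolynomial c N) = ∏ k, X k := by
  have homogeneousComponent_C {n : ℕ} (hn : 0 < n) (a : R) :
      homogeneousComponent n (C a : MvPolynomial σ R) = 0 :=
    homogeneousComponent_eq_zero _ _ ((totalDegree_C a).trans_lt hn)
  calc homogeneousComponent (Fintype.card σ) (boxPolynomial c N)
    _ = homogeneousComponent (∑ _k : σ, 1) (∏ k, (X k - C (c k))) := by
      rw [boxPolynomial, map_sub, homogeneousComponent_C Fintype.card_pos, sub_zero,
        Fintype.card_eq_sum_ones]
    _ = ∏ k, homogeneousComponent 1 (X k - C (c k)) :=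
      homogeneousComponent_prod_of_totalDegree_le _ fun k _ => totalDegree_X_sub_C_le k (c k)
    _ = ∏ k, X k := by
      simp only [map_sub, homogeneousComponent_C one_pos, sub_zero,
        homogeneousComponent_eq_self (isHomogeneous_X R _)]

end BoxPolynomials

namespace GainGraph

section Polynomial

open MvPolynomial

variable {V E : Type*} [Fintype V] {d : ℕ} {Φ : GainGraph V E (Fin d → ℤ)}
  (H : V → Set (Fin d → ℤ))

/-- The product over the parts of `B` in the summand of `pBar` indexed by `B`, as a polynomial in
the bound `m'`. -/
noncomputable def flatPolynomial (Φ : GainGraph V E (Fin d → ℤ)) (H : V → Set (Fin d → ℤ))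
    (B : Finset E) : MvPolynomial (Fin d) ℤ :=
  ∏ W ∈ Φ.parts B, boxPolynomial (fun k => Φ.partBase H B W k - 1) ((Φ.gapsOn H B W).ncard : ℤ)

theorem eval_flatPolynomial (B : Finset E) (m : Fin d → ℤ) :
    eval m (Φ.flatPolynomial H B) =
      ∏ W ∈ Φ.parts B, ((∏ k, Φ.qBar H B W m k) - ((Φ.gapsOn H B W).ncard : ℤ)) := by
  simp only [flatPolynomial, map_prod, eval_boxPolynomial, qBar_eq, sub_sub_eq_add_sub]

theorem totalDegree_flatPolynomial_le (B : Finset E) :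
    (Φ.flatPolynomial H B).totalDegree ≤ (Φ.parts B).card * d := by
  refine (totalDegree_finsetProd _ _).trans (Finset.sum_le_card_nsmul _ _ d fun W _ => ?_)
  simpa using totalDegree_boxPolynomial_le (fun k => Φ.partBase H B W k - 1) _

theorem totalDegree_C_mul_flatPolynomial_le (a : ℤ) (B : Finset E) :
    (C a * Φ.flatPolynomial H B).totalDegree ≤ (Φ.parts B).card * d := by
  refine (totalDegree_mul _ _).trans ?_
  rw [totalDegree_C, zero_add]
  exact totalDegree_flatPolynomial_le H B

theorem degreeOf_flatPolynomial_le (B : Finset E) (k : Fin d) :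
    (Φ.flatPolynomial H B).degreeOf k ≤ (Φ.parts B).card := by
  refine (degreeOf_prod_le _ _ _).trans ?_
  simpa using Finset.sum_le_card_nsmul _ _ 1 fun W _ => degreeOf_boxPolynomial_le _ _ k

theorem homogeneousComponent_flatPolynomial [NeZero d] (B : Finset E) :
    homogeneousComponent ((Φ.parts B).card * d) (Φ.flatPolynomial H B) =
      ∏ k, X k ^ (Φ.parts B).card := by
  have h := homogeneousComponent_prod_of_totalDegree_le (Φ.parts B) fun W _ =>
    totalDegree_boxPolynomial_le (fun k => Φ.partBase H B W k - 1) ((Φ.gapsOn H B W).ncard : ℤ)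
  simp only [homogeneousComponent_boxPolynomial] at h
  simpa only [flatPolynomial, Finset.sum_const, Finset.prod_const, Fintype.card_fin, smul_eq_mul,
    Finset.prod_pow] using h

variable [Finite E]

/-- The polynomial in `m'` whose value is `pBar`. -/
noncomputable def pBarPolynomial (Φ : GainGraph V E (Fin d → ℤ)) (H : V → Set (Fin d → ℤ)) :
    MvPolynomial (Fin d) ℤ :=
  ∑ B : Φ.LatB, C (Φ.muEmpty B) * Φ.flatPolynomial H B.1

theorem eval_pBarPolynomial (m : Fin d → ℤ) : eval m (Φ.pBarPolynomial H) = Φ.pBar H m := by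
  simp only [pBarPolynomial, pBar, map_sum, map_mul, eval_C, eval_flatPolynomial]

theorem degreeOf_pBarPolynomial_le (k : Fin d) :
    (Φ.pBarPolynomial H).degreeOf k ≤ Fintype.card V := by
  refine (degreeOf_sum_le _ _ _).trans (Finset.sup_le fun B _ => ?_)
  calc degreeOf k (C (Φ.muEmpty B) * Φ.flatPolynomial H B.1)
    _ ≤ degreeOf k (Φ.flatPolynomial H B.1) := degreeOf_C_mul_le _ _ _
    _ ≤ (Φ.parts B.1).card := degreeOf_flatPolynomial_le H B.1 k
    _ ≤ Fintype.card V := card_parts_le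

theorem homogeneousComponent_pBarPolynomial [NeZero d]
    (hloop : ∀ (e : E) (v : V), ¬ Φ.Traverses e v v 0)
    (hloose : ∀ e : E, Φ.kind e ≠ EdgeKind.loose) :
    homogeneousComponent (Fintype.card V * d) (Φ.pBarPolynomial H) =
      ∏ k, X k ^ Fintype.card V := by
  have hempty : Φ.Balanced ∅ ∧ Φ.Closed ∅ := ⟨balanced_empty, closed_empty hloop hloose⟩
  rw [pBarPolynomial, map_sum, Finset.sum_eq_single (⟨∅, hempty⟩ : Φ.LatB)]
  · rw [muEmpty_empty, C_1, one_mul, ← card_parts_empty (Φ := Φ),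
      homogeneousComponent_flatPolynomial]
  · intro B _ hB
    obtain ⟨e, he⟩ := Finset.nonempty_iff_ne_empty.2 fun h => hB (Subtype.ext h)
    obtain ⟨u, v, g, h⟩ := B.2.1.exists_traverses hloose he
    have hcard := card_parts_lt he h (B.2.1.ne_of_traverses hloop he h)
    exact homogeneousComponent_eq_zero _ _ ((totalDegree_C_mul_flatPolynomial_le H _ _).trans_lt
      (Nat.mul_lt_mul_of_pos_right hcard (NeZero.pos d)))
  · exact fun h => absurd (Finset.mem_univ _) h

theorem totalDegree_pBarPolynomial [NeZero d]
    (hloop : ∀ (e : E) (v : V), ¬ Φ.Traverses e v v 0)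
    (hloose : ∀ e : E, Φ.kind e ≠ EdgeKind.loose) :
    (Φ.pBarPolynomial H).totalDegree = Fintype.card V * d := by
  refine le_antisymm (totalDegree_finsetSum_le fun B _ => ?_) (le_of_not_gt fun hlt => ?_)
  · exact (totalDegree_C_mul_flatPolynomial_le H _ _).trans
      (Nat.mul_le_mul_right d card_parts_le)
  · have hlead := homogeneousComponent_pBarPolynomial H hloop hloose
    rw [homogeneousComponent_eq_zero _ _ hlt] at hlead
    exact Finset.prod_ne_zero_iff.2 (fun k _ => pow_ne_zero _ (X_ne_zero k)) hlead.symm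

end Polynomial

end GainGraph

theorem corollaryC {V E : Type*} [Fintype V] [Finite E] {d : ℕ} (hd : 0 < d)
    (Φ : GainGraph V E (Fin d → ℤ))
    (hloop : ∀ (e : E) (v : V), ¬ Φ.Traverses e v v 0)
    (hloose : ∀ e : E, Φ.kind e ≠ EdgeKind.loose)
    (H : V → Set (Fin d → ℤ)) (hH : ∀ i, IsW2 (H i)) :
    (∃ P : MvPolynomial (Fin d) ℤ,
      (∀ m' : Fin d → ℤ, MvPolynomial.eval m' P = Φ.pBar H m') ∧
      (∀ k, P.degreeOf k ≤ Fintype.card V) ∧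
      P.homogeneousComponent P.totalDegree =
        ∏ k : Fin d, (MvPolynomial.X k : MvPolynomial (Fin d) ℤ) ^ Fintype.card V) ∧
    ∀ m' : Fin d → ℤ, (∀ j, listHat (H j) + Φ.pathGainSup j ≤ m') →
      (Φ.properColorations H fun _ => m').Finite ∧
      ((Φ.chi H fun _ => m' : ℕ) : ℤ) = Φ.pBar H m' := by
  have : NeZero d := ⟨hd.ne'⟩
  refine ⟨⟨Φ.pBarPolynomial H, GainGraph.eval_pBarPolynomial H,
    GainGraph.degreeOf_pBarPolynomial_le H, ?_⟩,
    fun m' hm => ⟨?_, GainGraph.chi_eq_pBar hloop hloose hH hm⟩⟩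
  · rw [GainGraph.totalDegree_pBarPolynomial H hloop hloose]
    exact GainGraph.homogeneousComponent_pBarPolynomial H hloop hloose
  · exact (GainGraph.finite_listColorations hH _).subset (GainGraph.properColorations_subset _)
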